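/- For integers $n,k,g,\lambda$, an $egr(n,k,g,\lambda)$ graph is a finite simple $k$-regular graph of order $n$ and girth $g$ such that every edge is contained in exactly $\lambda$ distinct cycles of length $g$. Let $q$ be a prime power. Then there exists a generalized quadrangle of order $(q,q)$, and there exists an $$egr\bigl(2q^3,\;q,\;8,\;(q-1)^2\bigl((q-2)^2+1\bigr)\bigr)$$ graph. More precisely, let $F$ be a field with $q$ elements and let $W(q)$ be the symplectic quadrangle over $F$: its points are the points of $PG(3,q)$, its lines are the lines of $PG(3,q)$ that are totally isotropic for the alternating form $x_0y_1-x_1y_0+x_2y_3-x_3y_2$, and incidence is containment. Then $W(q)$ is a generalized quadrangle of order $(q,q)$, and for every point $P$ and every line $e_0$ of $W(q)$ incident with $P$, the incidence graph of the geometry obtained from $W(q)$ by deleting all points on the lines through $P$ (including $P$) and all lines incident with a point of $e_0$ (including $e_0$) is an $egr\bigl(2q^3,q,8,(q-1)^2((q-2)^2+1)\bigr)$ graph. -/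

import Mathlib

/-- The point-line geometry with incidence relation `I` is a (finite) generalized quadrangle of
order `(s, t)`. -/
structure IsGeneralizedQuadrangle {α β : Type*} (I : α → β → Prop) (s t : ℕ) : Prop where
  nonempty_points : Nonempty α
  nonempty_lines : Nonempty β
  one_le_s : 1 ≤ s
  one_le_t : 1 ≤ t
  /-- Every point is incident with exactly `t + 1` lines. -/
  card_lines : ∀ x : α, {L : β | I x L}.ncard = t + 1
  /-- Every line is incident with exactly `s + 1` points. -/
  card_points : ∀ L : β, {x : α | I x L}.ncard = s + 1
  /-- Two distinct points are incident with at most one common line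
  (equivalently, two distinct lines are incident with at most one common point). -/
  eq_or_eq : ∀ (x y : α) (L M : β), I x L → I y L → I x M → I y M → x = y ∨ L = M
  /-- For a non-incident point-line pair `(x, L)` there is a unique pair `(y, M)` with
  `x I M I y I L`. -/
  existsUnique_proj : ∀ (x : α) (L : β), ¬ I x L → ∃! p : α × β, I x p.2 ∧ I p.1 p.2 ∧ I p.1 L

/-- The incidence graph (Levi graph) of a point-line geometry. -/
def incidenceGraph {α β : Type*} (I : α → β → Prop) : SimpleGraph (α ⊕ β) where
  Adj
    | .inl x, .inr L => I x L
    | .inr L, .inl x => I x L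
    | _, _ => False
  symm := ⟨by rintro (x | L) (y | M) h <;> exact h⟩
  loopless := ⟨by rintro (x | L) h <;> exact h⟩

/-- The incidence graph of the geometry obtained from `I` by deleting all points lying on some line
through the point `P` (so also `P` itself) and all lines incident with some point of the line `e`
(so also `e` itself, when it has a point). -/
def deletedIncidenceGraph {α β : Type*} (I : α → β → Prop) (P : α) (e : β) :
    SimpleGraph ({x : α // ¬ ∃ L, I P L ∧ I x L} ⊕ {M : β // ¬ ∃ y, I y e ∧ I y M}) :=
  incidenceGraph fun x M => I x.1 M.1

/-- The subgraph `H` of `G` is a cycle of length `g`. -/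
def IsCycleSubgraph {V : Type*} (G : SimpleGraph V) (g : ℕ) (H : G.Subgraph) : Prop :=
  ∃ (v : V) (c : G.Walk v v), c.IsCycle ∧ c.length = g ∧ c.toSubgraph = H

/-- `G` is an edge-girth-regular graph `egr(n, k, g, l)`: a finite `k`-regular graph of order `n`
and girth `g`, every edge of which lies in exactly `l` distinct cycles of length `g`. -/
structure IsEdgeGirthRegular {V : Type*} (G : SimpleGraph V) (n k g l : ℕ) : Prop where
  finite : Finite V
  order : Nat.card V = n
  regular : ∀ v : V, (G.neighborSet v).ncard = k
  girth : G.egirth = g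
  cycles : ∀ e ∈ G.edgeSet, {H : G.Subgraph | IsCycleSubgraph G g H ∧ e ∈ H.edgeSet}.ncard = l

/-- The standard symplectic (nondegenerate alternating) form on `F⁴`. -/
def symplecticForm {F : Type*} [Field F] (x y : Fin 4 → F) : F :=
  x 0 * y 1 - x 1 * y 0 + x 2 * y 3 - x 3 * y 2

/-- The lines of the symplectic quadrangle `W(F)`: the lines of `PG(3, F)`, that is, the
2-dimensional subspaces of `F⁴`, which are totally isotropic. -/
def SymplecticLine (F : Type*) [Field F] : Type _ :=
  {L : Submodule F (Fin 4 → F) //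
    Module.finrank F L = 2 ∧ ∀ x ∈ L, ∀ y ∈ L, symplecticForm x y = 0}

/-- The incidence relation of the symplectic quadrangle `W(F)`, whose points are all the points of
`PG(3, F)`. -/
def symplecticIncidence (F : Type*) [Field F]
    (P : Projectivization F (Fin 4 → F)) (L : SymplecticLine F) : Prop :=
  P.submodule ≤ L.1

/-!
In `W(q)` a line is its own orthogonal complement, so the points of a line `L` collinear with a
point `x` off `L` form the intersection of `L` with the hyperplane orthogonal to `x`, a single
point.

Let a flag `(P, e)` of a quadrangle of order `(s, t)` be deleted. A cycle of length less than `8` in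
an incidence graph is a triangle or a pair of lines with two common points, so the girth is at least
`8`. The cycles of length `8` through the edge `x L` are the closed paths `x K w N z M y L`. Choose
`K ≠ L` through `x` and `y ≠ x` on `L`; any further point `w` of `K` and line `M ≠ L` through `y`
are joined by a unique flag `(z, N)`, and only the pairs `(w, M)` with `z` or `N` deleted have to be
discarded. Projecting `P` on the lines `M` and these projections on `K` shows that `t - 2` pairs
have `z` collinear with `P`; dually `s - 2` pairs have `N` meeting `e`, and no pair has both. This
leaves `(s - 1)(t - 1) - (s - 2) - (t - 2) = (s - 2)(t - 2) + 1` pairs.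
-/

section IsotropicLines

open Module
open LinearMap (BilinForm)
open scoped LinearAlgebra.Projectivization

variable {F V : Type*} [Field F] [AddCommGroup V] [Module F V]

lemma finrank_sup_submodule {P Q : ℙ F V} (hPQ : P ≠ Q) :
    finrank F ↥(P.submodule ⊔ Q.submodule) = 2 := by
  have hspan : P.submodule ⊔ Q.submodule = Submodule.span F (Set.range ![P.rep, Q.rep]) := by
    rw [P.submodule_eq, Q.submodule_eq, Matrix.range_cons_cons_empty, Submodule.span_insert]
  rw [hspan, finrank_span_eq_card (Projectivization.linearIndependent_pair_iff_ne.2 hPQ),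
    Fintype.card_fin]

lemma eq_sup_submodule {L : Submodule F V} (hL : finrank F L = 2) {P Q : ℙ F V} (hPQ : P ≠ Q)
    (hP : P.submodule ≤ L) (hQ : Q.submodule ≤ L) : L = P.submodule ⊔ Q.submodule := by
  have : FiniteDimensional F L := Module.finite_of_finrank_eq_succ hL
  exact (Submodule.eq_of_le_of_finrank_eq (sup_le hP hQ)
    ((finrank_sup_submodule hPQ).trans hL.symm)).symm

theorem existsUnique_submodule_le_inf [FiniteDimensional F V] {L H : Submodule F V}
    (hL : finrank F L = 2) (hH : finrank F H + 1 = finrank F V) (hLH : ¬ L ≤ H) :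
    ∃! P : ℙ F V, P.submodule ≤ L ⊓ H := by
  have hlt : finrank F H < finrank F ↥(L ⊔ H) :=
    Submodule.finrank_lt_finrank_of_lt (right_lt_sup.2 hLH)
  have hle : finrank F ↥(L ⊔ H) ≤ finrank F V := Submodule.finrank_le _
  have hdim := Submodule.finrank_sup_add_finrank_inf_eq L H
  have hinf : finrank F ↥(L ⊓ H) = 1 := by omega
  refine ⟨.mk'' _ hinf, (Projectivization.submodule_mk'' _ hinf).le, fun P hP => ?_⟩
  apply Projectivization.submodule_injective
  rw [Projectivization.submodule_mk'']
  exact Submodule.eq_of_le_of_finrank_eq hP (P.finrank_submodule.trans hinf.symm)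

lemma ncard_setOf_submodule_le (W : Submodule F V) :
    {P : ℙ F V | P.submodule ≤ W}.ncard = Nat.card (ℙ F W) := by
  have hrange : {P : ℙ F V | P.submodule ≤ W} =
      Set.range (Projectivization.map W.subtype W.injective_subtype) := by
    ext P
    constructor
    · intro hP
      have hmem : P.rep ∈ W := by
        rwa [← Submodule.span_singleton_le_iff_mem, ← P.submodule_eq]
      exact ⟨.mk F ⟨P.rep, hmem⟩ (by simpa [Subtype.ext_iff] using P.rep_nonzero), P.mk_rep⟩
    · rintro ⟨Q, rfl⟩
      induction Q using Projectivization.ind with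
      | h v hv =>
        rw [Projectivization.map_mk, Set.mem_ofPred_eq, Projectivization.submodule_mk,
          Submodule.span_singleton_le_iff_mem]
        exact v.2
  rw [hrange]
  exact Nat.card_range_of_injective (Projectivization.map_injective _ _)

variable {B : BilinForm F V}

lemma le_orthogonal_comm (hB : B.IsRefl) {W W' : Submodule F V} :
    W ≤ B.orthogonal W' ↔ W' ≤ B.orthogonal W :=
  ⟨fun h x hx y hy => hB x y (h hy x hx), fun h x hx y hy => hB x y (h hy x hx)⟩

lemma submodule_le_orthogonal_self (hB : B.IsAlt) (P : ℙ F V) :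
    P.submodule ≤ B.orthogonal P.submodule := by
  rw [P.submodule_eq, Submodule.span_singleton_le_iff_mem,
    LinearMap.BilinForm.orthogonal_span_singleton_eq_toLin_ker]
  exact hB.self_eq_zero P.rep

/-- The totally isotropic lines of the projective space of `V`, as two-dimensional subspaces. -/
def IsIsotropicLine (B : BilinForm F V) (L : Submodule F V) : Prop :=
  finrank F L = 2 ∧ ∀ x ∈ L, ∀ y ∈ L, B x y = 0

lemma IsIsotropicLine.le_orthogonal {L : Submodule F V} (hL : IsIsotropicLine B L) :
    L ≤ B.orthogonal L :=
  fun x hx y hy => hL.2 y hy x hx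

lemma IsIsotropicLine.orthogonal_eq {L : Submodule F V} (hL : IsIsotropicLine B L)
    (hB : B.Nondegenerate) (hV : finrank F V = 4) : B.orthogonal L = L := by
  have : FiniteDimensional F V := Module.finite_of_finrank_eq_succ hV
  refine (Submodule.eq_of_le_of_finrank_eq hL.le_orthogonal ?_).symm
  rw [LinearMap.BilinForm.finrank_orthogonal hB, hV, hL.1]

lemma isIsotropicLine_sup (hB : B.IsAlt) {P Q : ℙ F V} (hPQ : P ≠ Q)
    (h : Q.submodule ≤ B.orthogonal P.submodule) :
    IsIsotropicLine B (P.submodule ⊔ Q.submodule) := by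
  have hP : P.submodule ≤ B.orthogonal (P.submodule ⊔ Q.submodule) :=
    (le_orthogonal_comm hB.isRefl).1 (sup_le (submodule_le_orthogonal_self hB P) h)
  have hQ : Q.submodule ≤ B.orthogonal (P.submodule ⊔ Q.submodule) :=
    (le_orthogonal_comm hB.isRefl).1
      (sup_le ((le_orthogonal_comm hB.isRefl).1 h) (submodule_le_orthogonal_self hB Q))
  exact ⟨finrank_sup_submodule hPQ, fun x hx y hy => sup_le hP hQ hy x hx⟩

lemma finrank_orthogonal_submodule_add_one (hB : B.Nondegenerate) [FiniteDimensional F V]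
    (P : ℙ F V) : finrank F (B.orthogonal P.submodule) + 1 = finrank F V := by
  have hle : finrank F P.submodule ≤ finrank F V := Submodule.finrank_le _
  rw [P.finrank_submodule] at hle
  rw [LinearMap.BilinForm.finrank_orthogonal hB, P.finrank_submodule, Nat.sub_add_cancel hle]

lemma exists_not_submodule_le_orthogonal (hB : B.Nondegenerate) (P : ℙ F V) :
    ∃ Q : ℙ F V, ¬ P.submodule ≤ B.orthogonal Q.submodule := by
  by_contra! h
  refine P.rep_nonzero (hB.2 _ fun v => ?_)
  obtain rfl | hv := eq_or_ne v 0
  · simp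
  · have hP := h (.mk F v hv)
    rw [P.submodule_eq, Submodule.span_singleton_le_iff_mem] at hP
    exact hP v (Submodule.mem_span_singleton_self v)

/-- Incidence between the points of the projective space of `V` and its totally isotropic lines. -/
def isotropicIncidence (B : BilinForm F V) (P : ℙ F V) (L : {L // IsIsotropicLine B L}) : Prop :=
  P.submodule ≤ L.1

-- For `y` not orthogonal to `x`, every isotropic line through `x` meets the line `⟨x, y⟩ᗮ` in
-- exactly one point, and every point of `⟨x, y⟩ᗮ` arises.
theorem ncard_isotropicIncidence_lines [Finite F] (hB : B.Nondegenerate) (hB' : B.IsAlt)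
    (hV : finrank F V = 4) (x : ℙ F V) :
    {L | isotropicIncidence B x L}.ncard = Nat.card F + 1 := by
  have : FiniteDimensional F V := Module.finite_of_finrank_eq_succ hV
  obtain ⟨y, hxy⟩ := exists_not_submodule_le_orthogonal hB x
  have hne {Q : ℙ F V} (hQ : Q.submodule ≤ B.orthogonal y.submodule) : x ≠ Q := by
    rintro rfl
    exact hxy hQ
  have hW : finrank F (B.orthogonal (x.submodule ⊔ y.submodule)) = 2 := by
    rw [LinearMap.BilinForm.finrank_orthogonal hB, hV,
      finrank_sup_submodule (hne (submodule_le_orthogonal_self hB' y))]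
  have hW_le {z : ℙ F V} (hz : z.submodule ≤ B.orthogonal (x.submodule ⊔ y.submodule)) :
      z.submodule ≤ B.orthogonal x.submodule ∧ z.submodule ≤ B.orthogonal y.submodule :=
    ⟨hz.trans (B.orthogonal_le le_sup_left), hz.trans (B.orthogonal_le le_sup_right)⟩
  have hmeet {L : Submodule F V} (hL : finrank F L = 2) (hxL : x.submodule ≤ L) :
      ∃! z : ℙ F V, z.submodule ≤ L ⊓ B.orthogonal y.submodule :=
    existsUnique_submodule_le_inf hL (finrank_orthogonal_submodule_add_one hB y)
      fun h => hxy (hxL.trans h)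
  rw [← Projectivization.card_of_finrank_two F _ hW, ← ncard_setOf_submodule_le]
  symm
  refine Set.ncard_congr (fun z hz => ⟨x.submodule ⊔ z.submodule,
    isIsotropicLine_sup hB' (hne (hW_le hz).2) (hW_le hz).1⟩) ?_ ?_ ?_
  · exact fun z _ => (le_sup_left : x.submodule ≤ x.submodule ⊔ z.submodule)
  · intro z z' hz hz' h
    have hL : x.submodule ⊔ z.submodule = x.submodule ⊔ z'.submodule := congrArg Subtype.val h
    exact (hmeet (finrank_sup_submodule (hne (hW_le hz).2)) le_sup_left).unique
      (le_inf le_sup_right (hW_le hz).2) (hL ▸ le_inf le_sup_right (hW_le hz').2)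
  · rintro ⟨L, hL⟩ (hxL : x.submodule ≤ L)
    obtain ⟨z, hz, -⟩ := hmeet hL.1 hxL
    obtain ⟨hzL, hzy⟩ := le_inf_iff.1 hz
    have hzx : z.submodule ≤ B.orthogonal x.submodule :=
      (hzL.trans hL.le_orthogonal).trans (B.orthogonal_le hxL)
    refine ⟨z, ?_, Subtype.ext (eq_sup_submodule hL.1 (hne hzy) hxL hzL).symm⟩
    exact (le_orthogonal_comm hB'.isRefl).1 (sup_le ((le_orthogonal_comm hB'.isRefl).1 hzx)
      ((le_orthogonal_comm hB'.isRefl).1 hzy))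

-- The projection of `x` on `L` is the point `L ⊓ xᗮ`, since `L = Lᗮ`.
lemma existsUnique_isotropicIncidence_proj (hB : B.Nondegenerate) (hB' : B.IsAlt)
    (hV : finrank F V = 4) (x : ℙ F V) (L : {L // IsIsotropicLine B L})
    (hxL : ¬ isotropicIncidence B x L) :
    ∃! p : ℙ F V × {L // IsIsotropicLine B L}, isotropicIncidence B x p.2 ∧
      isotropicIncidence B p.1 p.2 ∧ isotropicIncidence B p.1 L := by
  have : FiniteDimensional F V := Module.finite_of_finrank_eq_succ hV
  obtain ⟨L, hL⟩ := L
  have hLx : ¬ L ≤ B.orthogonal x.submodule := by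
    rw [le_orthogonal_comm hB'.isRefl, hL.orthogonal_eq hB hV]
    exact hxL
  obtain ⟨y, hy, hy_unique⟩ := existsUnique_submodule_le_inf hL.1
    (finrank_orthogonal_submodule_add_one hB x) hLx
  obtain ⟨hyL, hyx⟩ := le_inf_iff.1 hy
  have hxy : x ≠ y := by
    rintro rfl
    exact hxL hyL
  refine ⟨(y, ⟨_, isIsotropicLine_sup hB' hxy hyx⟩), ⟨le_sup_left, le_sup_right, hyL⟩, ?_⟩
  rintro ⟨z, M, hM⟩ ⟨hxM : x.submodule ≤ M, hzM : z.submodule ≤ M, hzL : z.submodule ≤ L⟩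
  have hzx : z.submodule ≤ B.orthogonal x.submodule :=
    (hzM.trans hM.le_orthogonal).trans (B.orthogonal_le hxM)
  obtain rfl : z = y := hy_unique z (le_inf hzL hzx)
  exact Prod.ext rfl (Subtype.ext (eq_sup_submodule hM.1 hxy hxM hzM))

theorem isGeneralizedQuadrangle_isotropicIncidence [Finite F] (hB : B.Nondegenerate)
    (hB' : B.IsAlt) (hV : finrank F V = 4) :
    IsGeneralizedQuadrangle (isotropicIncidence B) (Nat.card F) (Nat.card F) := by
  have : Nontrivial V := Module.nontrivial_of_finrank_eq_succ hV
  obtain ⟨x⟩ : Nonempty (ℙ F V) := inferInstance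
  have hlines : {L | isotropicIncidence B x L}.Nonempty := by
    apply Set.nonempty_of_ncard_ne_zero
    rw [ncard_isotropicIncidence_lines hB hB' hV]
    exact Nat.succ_ne_zero _
  exact {
    nonempty_points := ⟨x⟩
    nonempty_lines := ⟨hlines.some⟩
    one_le_s := Nat.card_pos
    one_le_t := Nat.card_pos
    card_lines := ncard_isotropicIncidence_lines hB hB' hV
    card_points L := (ncard_setOf_submodule_le L.1).trans
      (Projectivization.card_of_finrank_two F _ L.2.1)
    eq_or_eq x y L M hxL hyL hxM hyM := or_iff_not_imp_left.2 fun hxy => Subtype.ext <|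
      (eq_sup_submodule L.2.1 hxy hxL hyL).trans (eq_sup_submodule M.2.1 hxy hxM hyM).symm
    existsUnique_proj := existsUnique_isotropicIncidence_proj hB hB' hV }

end IsotropicLines

section Symplectic

variable {F : Type*} [Field F]

/-- The form `symplecticForm` as a bilinear form. -/
def symplecticBilin (F : Type*) [Field F] : LinearMap.BilinForm F (Fin 4 → F) :=
  LinearMap.mk₂ F symplecticForm
    (by intros; simp only [symplecticForm, Pi.add_apply]; ring)
    (by intros; simp only [symplecticForm, Pi.smul_apply, smul_eq_mul]; ring)
    (by intros; simp only [symplecticForm, Pi.add_apply]; ring)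
    (by intros; simp only [symplecticForm, Pi.smul_apply, smul_eq_mul]; ring)

lemma isAlt_symplecticBilin : (symplecticBilin F).IsAlt := fun x => by
  change x 0 * x 1 - x 1 * x 0 + x 2 * x 3 - x 3 * x 2 = 0
  ring

lemma nondegenerate_symplecticBilin : (symplecticBilin F).Nondegenerate := by
  refine (LinearMap.IsRefl.nondegenerate_iff_separatingLeft (B := symplecticBilin F)
    isAlt_symplecticBilin.isRefl).2 fun v hv => ?_
  have h (i : Fin 4) : symplecticForm v (Pi.single i 1) = 0 := hv _
  have h0 : v 0 = 0 := by simpa [symplecticForm] using h 1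
  have h1 : v 1 = 0 := by simpa [symplecticForm] using h 0
  have h2 : v 2 = 0 := by simpa [symplecticForm] using h 3
  have h3 : v 3 = 0 := by simpa [symplecticForm] using h 2
  ext i
  fin_cases i <;> assumption

theorem isGeneralizedQuadrangle_symplecticIncidence (F : Type*) [Field F] [Finite F] :
    IsGeneralizedQuadrangle (symplecticIncidence F) (Nat.card F) (Nat.card F) :=
  isGeneralizedQuadrangle_isotropicIncidence (B := symplecticBilin F)
    nondegenerate_symplecticBilin isAlt_symplecticBilin (Module.finrank_fin_fun F)

end Symplectic

lemma card_sigma_of_card_eq {A : Type*} {B : A → Type*} {m : ℕ} (h : ∀ a, Nat.card (B a) = m) :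
    Nat.card (Σ a, B a) = Nat.card A * m := by
  obtain rfl | hm := m.eq_zero_or_pos
  · rw [mul_zero, Nat.card_eq_zero]
    by_cases hA : ∃ a, Infinite (B a)
    · obtain ⟨a, _⟩ := hA
      exact .inr (Infinite.of_injective (Sigma.mk a) sigma_mk_injective)
    · simp only [not_exists, not_infinite_iff_finite] at hA
      exact .inl ⟨fun p => ((Nat.card_eq_zero.1 (h p.1)).resolve_right (hA p.1).not_infinite).false
        p.2⟩
  · have (a : A) : Finite (B a) := Nat.finite_of_card_ne_zero ((h a).trans_ne hm.ne')
    rw [Nat.card_congr ((Equiv.sigmaCongrRight fun a => Finite.equivFinOfCardEq (h a)).trans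
      (Equiv.sigmaEquivProd A (Fin m))), Nat.card_prod, Nat.card_fin]

section CyclesThroughEdge

open SimpleGraph

variable {V : Type*} {G : SimpleGraph V} {a b : V}

lemma eq_of_isPath_of_edges_subset {p p' : G.Walk a b} (hp : p.IsPath) (hp' : p'.IsPath)
    (h : p.edges ⊆ p'.edges) : p = p' := by
  induction p with
  | nil => exact (Walk.isPath_iff_nil.1 hp').eq_nil.symm
  | @cons u v w huv p ih =>
    obtain ⟨hp, hu⟩ := (Walk.cons_isPath_iff _ _).1 hp
    cases p' with
    | nil => exact absurd (h (List.mem_cons_self (a := s(u, v)))) List.not_mem_nil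
    | @cons _ v' _ huv' p' =>
      obtain ⟨hp', hu'⟩ := (Walk.cons_isPath_iff _ _).1 hp'
      have hv : v = v' := by
        have hmem : s(u, v) ∈ (Walk.cons huv' p').edges := h (by simp)
        rw [Walk.edges_cons, List.mem_cons] at hmem
        obtain heq | hmem := hmem
        · exact Sym2.congr_right.1 heq
        · exact absurd (p'.fst_mem_support_of_mem_edges hmem) hu'
      subst hv
      congr 1
      refine ih hp hp' fun ε hε => ?_
      have hmem := h (List.mem_cons_of_mem _ hε)
      rw [Walk.edges_cons, List.mem_cons] at hmem
      refine hmem.resolve_left ?_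
      rintro rfl
      exact hu (p.fst_mem_support_of_mem_edges hε)

lemma isCycle_cons_of_isPath {p : G.Walk b a} (hp : p.IsPath) (hlen : 2 ≤ p.length)
    (hab : G.Adj a b) : (Walk.cons hab p).IsCycle := by
  rw [Walk.isCycle_iff_isPath_tail_and_le_length, Walk.length_cons]
  exact ⟨by simpa using hp, Nat.succ_le_succ hlen⟩

lemma exists_isPath_cons_of_snd_eq {c : G.Walk a a} (hc : c.IsCycle) (hsnd : c.snd = b) :
    ∃ (hab : G.Adj a b) (p : G.Walk b a), p.IsPath ∧ c = .cons hab p := by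
  cases c with
  | nil => exact absurd hc Walk.not_isCycle_nil
  | cons h p =>
    rw [Walk.snd_cons] at hsnd
    subst hsnd
    exact ⟨h, p, ((Walk.cons_isCycle_iff p h).1 hc).1, rfl⟩

lemma exists_isPath_cons_toSubgraph_eq {v : V} {c : G.Walk v v} (hc : c.IsCycle)
    (hab : s(a, b) ∈ c.edges) : ∃ (h : G.Adj a b) (p : G.Walk b a), p.IsPath ∧
      p.length + 1 = c.length ∧ (Walk.cons h p).toSubgraph = c.toSubgraph := by
  classical
  have ha := c.fst_mem_support_of_mem_edges hab
  have hcycle := hc.rotate ha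
  have hmem : b ∈ (c.rotate a ha).toSubgraph.neighborSet a := by
    rwa [Walk.toSubgraph_rotate, Subgraph.mem_neighborSet, ← Subgraph.mem_edgeSet,
      Walk.mem_edges_toSubgraph]
  rw [hcycle.neighborSet_toSubgraph_endpoint] at hmem
  obtain ⟨d, hd, hsnd, hlen, hsub⟩ : ∃ d : G.Walk a a, d.IsCycle ∧ d.snd = b ∧
      d.length = c.length ∧ d.toSubgraph = c.toSubgraph := by
    obtain rfl | rfl := hmem
    · exact ⟨_, hcycle, rfl, c.length_rotate a ha, c.toSubgraph_rotate ha⟩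
    · exact ⟨_, hcycle.reverse, Walk.snd_reverse _,
        (Walk.length_reverse _).trans (c.length_rotate a ha),
        (Walk.toSubgraph_reverse _).trans (c.toSubgraph_rotate ha)⟩
  obtain ⟨h, p, hp, rfl⟩ := exists_isPath_cons_of_snd_eq hd hsnd
  exact ⟨h, p, hp, hlen, hsub⟩

theorem ncard_cycleSubgraphs_through_edge (hab : G.Adj a b) {n : ℕ} (hn : 2 ≤ n) :
    {H : G.Subgraph | IsCycleSubgraph G (n + 1) H ∧ s(a, b) ∈ H.edgeSet}.ncard =
      {p : G.Walk b a | p.IsPath ∧ p.length = n}.ncard := by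
  symm
  refine Set.ncard_congr (fun p _ => (Walk.cons hab p).toSubgraph) ?_ ?_ ?_
  · rintro p ⟨hp, rfl⟩
    exact ⟨⟨a, _, isCycle_cons_of_isPath hp hn hab, Walk.length_cons _ _, rfl⟩, by simp⟩
  · rintro p p' ⟨hp, rfl⟩ ⟨hp', -⟩ h
    refine eq_of_isPath_of_edges_subset hp hp' fun ε hε => ?_
    have hmem : ε ∈ (Walk.cons hab p').toSubgraph.edgeSet := by
      rw [← h, Walk.mem_edges_toSubgraph]
      exact List.mem_cons_of_mem _ hε
    rw [Walk.mem_edges_toSubgraph, Walk.edges_cons, List.mem_cons] at hmem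
    refine hmem.resolve_left ?_
    rintro rfl
    exact ((Walk.cons_isCycle_iff p hab).1 (isCycle_cons_of_isPath hp hn hab)).2 hε
  · rintro H ⟨⟨v, c, hc, hlen, rfl⟩, hmem⟩
    rw [Walk.mem_edges_toSubgraph] at hmem
    obtain ⟨h, p, hp, hplen, hsub⟩ := exists_isPath_cons_toSubgraph_eq hc hmem
    exact ⟨p, ⟨hp, Nat.succ_injective (hplen.trans hlen)⟩, hsub⟩

end CyclesThroughEdge

section TriangleFree

variable {α β : Type*} {I : α → β → Prop}

/-- The flag `(y, M)` is a projection of the point `x` onto the line `L`: `M` joins `x` to the point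
`y` of `L`. -/
def IsProj (I : α → β → Prop) (x : α) (L : β) (y : α) (M : β) : Prop :=
  I x M ∧ I y M ∧ I y L

lemma isProj_flip {x y : α} {L M : β} : IsProj (flip I) L x M y ↔ IsProj I x L y M := by
  simp only [IsProj, flip]
  tauto

/-- A partial linear space without triangles. Two distinct lines through a point `x` off `L` that
meet `L` would form a triangle with `L`, so the absence of triangles is stated as uniqueness of
projections. -/
structure IsTriangleFree (I : α → β → Prop) : Prop where
  eq_or_eq {x y : α} {L M : β} : I x L → I y L → I x M → I y M → x = y ∨ L = M
  proj_unique {x y z : α} {L M N : β} :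
    ¬ I x L → IsProj I x L y M → IsProj I x L z N → y = z ∧ M = N

namespace IsTriangleFree

protected lemma flip (h : IsTriangleFree I) : IsTriangleFree (flip I) where
  eq_or_eq hxL hxM hyL hyM := (h.eq_or_eq hxL hyL hxM hyM).symm
  proj_unique hxL hM hN := (h.proj_unique hxL (isProj_flip.1 hM) (isProj_flip.1 hN)).symm

lemma comap (h : IsTriangleFree I) {α' β' : Type*} {f : α' → α} {g : β' → β}
    (hf : f.Injective) (hg : g.Injective) : IsTriangleFree fun x L => I (f x) (g L) where
  eq_or_eq hxL hyL hxM hyM := (h.eq_or_eq hxL hyL hxM hyM).imp (@hf _ _) (@hg _ _)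
  proj_unique hxL hM hN := (h.proj_unique hxL hM hN).imp (@hf _ _) (@hg _ _)

lemma not_inc (h : IsTriangleFree I) {x y : α} {L M : β} (hxL : I x L) (hyL : I y L)
    (hxM : I x M) (hxy : x ≠ y) (hLM : L ≠ M) : ¬ I y M :=
  fun hyM => (h.eq_or_eq hxL hyL hxM hyM).elim hxy hLM

section Quadrangle

variable {x y z w : α} {K L M N : β}

lemma not_inc_of_isPath (h : IsTriangleFree I) (hxK : I x K) (hwK : I w K) (hxL : I x L)
    (hyL : I y L) (hyM : I y M) (hxy : x ≠ y) (hKL : K ≠ L) (hLM : L ≠ M) : ¬ I w M :=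
  fun hwM => hKL (h.proj_unique (h.not_inc hyL hxL hyM hxy.symm hLM) ⟨hxK, hwK, hwM⟩
    ⟨hxL, hyL, hyM⟩).2

lemma nodup_points (h : IsTriangleFree I) (hxK : I x K) (hwK : I w K) (hwN : I w N) (hzN : I z N)
    (hzM : I z M) (hyM : I y M) (hyL : I y L) (hxL : I x L) (hKL : K ≠ L) (hxy : x ≠ y)
    (hxw : x ≠ w) (hLM : L ≠ M) : [x, w, z, y].Nodup := by
  have hwL : ¬ I w L := h.not_inc hxK hwK hxL hxw hKL
  have hxM : ¬ I x M := h.not_inc hyL hxL hyM hxy.symm hLM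
  have hwM : ¬ I w M := h.not_inc_of_isPath hxK hwK hxL hyL hyM hxy hKL hLM
  have hxz : x ≠ z := fun hxz => hxM (hxz ▸ hzM)
  have hwz : w ≠ z := fun hwz => hwM (hwz ▸ hzM)
  have hwy : w ≠ y := fun hwy => hwL (hwy ▸ hyL)
  have hzy : z ≠ y := by
    rintro rfl
    exact hxy (h.proj_unique hwL ⟨hwK, hxK, hxL⟩ ⟨hwN, hzN, hyL⟩).1
  simp [hxw, hxz, hxy, hwz, hwy, hzy]

lemma nodup_lines (h : IsTriangleFree I) (hxK : I x K) (hwK : I w K) (hwN : I w N) (hzN : I z N)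
    (hzM : I z M) (hyM : I y M) (hyL : I y L) (hxL : I x L) (hKL : K ≠ L) (hxy : x ≠ y)
    (hxw : x ≠ w) (hLM : L ≠ M) : [L, M, N, K].Nodup :=
  h.flip.nodup_points hyL hyM hzM hzN hwN hwK hxK hxL hxy.symm hKL.symm hLM hxw

end Quadrangle

end IsTriangleFree

end TriangleFree

section IncidenceGraph

open SimpleGraph

variable {α β : Type*} {I : α → β → Prop}

@[simp] lemma incidenceGraph_adj_inl_inr {x : α} {L : β} :
    (incidenceGraph I).Adj (.inl x) (.inr L) ↔ I x L := Iff.rfl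

@[simp] lemma incidenceGraph_adj_inr_inl {x : α} {L : β} :
    (incidenceGraph I).Adj (.inr L) (.inl x) ↔ I x L := Iff.rfl

@[simp] lemma not_incidenceGraph_adj_inl_inl {x y : α} :
    ¬ (incidenceGraph I).Adj (.inl x) (.inl y) := id

@[simp] lemma not_incidenceGraph_adj_inr_inr {L M : β} :
    ¬ (incidenceGraph I).Adj (.inr L) (.inr M) := id

lemma ncard_neighborSet_incidenceGraph_inl (x : α) :
    ((incidenceGraph I).neighborSet (.inl x)).ncard = {L | I x L}.ncard := by
  rw [← Set.ncard_image_of_injective {L | I x L} (Sum.inr_injective (α := α))]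
  congr 1
  ext (y | L) <;> simp

lemma ncard_neighborSet_incidenceGraph_inr (L : β) :
    ((incidenceGraph I).neighborSet (.inr L)).ncard = {x | I x L}.ncard := by
  rw [← Set.ncard_image_of_injective {x | I x L} (Sum.inl_injective (β := β))]
  congr 1
  ext (y | L) <;> simp

lemma incidenceGraph_colorable_two (I : α → β → Prop) : (incidenceGraph I).Colorable 2 :=
  (Coloring.mk (Sum.isLeft : α ⊕ β → Bool) (by rintro (x | L) (y | M) <;> simp)).colorable

/-- The walk `x, L, y` in an incidence graph, followed by a walk from `y`. -/
def walkVia {x y : α} {L : β} {v : α ⊕ β} (hx : I x L) (hy : I y L)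
    (p : (incidenceGraph I).Walk (.inl y) v) : (incidenceGraph I).Walk (.inl x) v :=
  .cons (v := .inr L) (incidenceGraph_adj_inl_inr.2 hx) (.cons (incidenceGraph_adj_inr_inl.2 hy) p)

@[simp] lemma length_walkVia {x y : α} {L : β} {v : α ⊕ β} (hx : I x L) (hy : I y L)
    (p : (incidenceGraph I).Walk (.inl y) v) : (walkVia hx hy p).length = p.length + 2 := rfl

@[simp] lemma support_walkVia {x y : α} {L : β} {v : α ⊕ β} (hx : I x L) (hy : I y L)
    (p : (incidenceGraph I).Walk (.inl y) v) :
    (walkVia hx hy p).support = .inl x :: .inr L :: p.support := rfl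

lemma exists_eq_walkVia {x : α} {v : α ⊕ β} (p : (incidenceGraph I).Walk (.inl x) v)
    (hp : 2 ≤ p.length) : ∃ (L : β) (y : α) (hx : I x L) (hy : I y L)
      (p' : (incidenceGraph I).Walk (.inl y) v), p = walkVia hx hy p' := by
  rcases p with _ | ⟨hxu, _ | ⟨huw, p⟩⟩
  · simp at hp
  · simp at hp
  · rename_i u w
    rcases u with z | L
    · exact hxu.elim
    · rcases w with y | M
      · exact ⟨L, y, hxu, huw, p, rfl⟩
      · exact huw.elim

lemma IsTriangleFree.eight_le_length (h : IsTriangleFree I) {x : α}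
    {c : (incidenceGraph I).Walk (.inl x) (.inl x)} (hc : c.IsCycle) : 8 ≤ c.length := by
  have hlen := hc.three_le_length
  have heven : Even c.length :=
    two_colorable_iff_forall_loop_even.1 (incidenceGraph_colorable_two I) _ c
  have hnodup := hc.support_nodup
  by_contra! hlt
  obtain ⟨L, y, hxL, hyL, p, rfl⟩ := exists_eq_walkVia c (by lia)
  rw [length_walkVia] at hlen heven hlt
  obtain ⟨M, z, hyM, hzM, p, rfl⟩ := exists_eq_walkVia p (by grind)
  rw [length_walkVia] at heven hlt
  obtain hp | hp : p.length = 0 ∨ 2 ≤ p.length := by grind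
  · obtain rfl : z = x := Sum.inl_injective (Walk.eq_of_length_eq_zero hp)
    obtain rfl := (Walk.length_eq_zero_iff.1 hp).eq_nil
    obtain ⟨hLM, hyx⟩ : L ≠ M ∧ y ≠ z := by simpa using hnodup
    exact (h.eq_or_eq hyL hxL hyM hzM).elim hyx hLM
  · obtain ⟨N, w, hzN, hwN, p, rfl⟩ := exists_eq_walkVia p hp
    rw [length_walkVia] at hlt heven
    have hp : p.length = 0 := by grind
    obtain rfl : w = x := Sum.inl_injective (Walk.eq_of_length_eq_zero hp)
    obtain rfl := (Walk.length_eq_zero_iff.1 hp).eq_nil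
    obtain ⟨⟨hLM, -⟩, ⟨hyz, hyw⟩, -⟩ :
      (L ≠ M ∧ L ≠ N) ∧ (y ≠ z ∧ y ≠ w) ∧ M ≠ N ∧ z ≠ w := by simpa using hnodup
    exact hyz (h.proj_unique (h.not_inc hyL hxL hyM hyw hLM) ⟨hxL, hyL, hyM⟩ ⟨hwN, hzN, hzM⟩).1

theorem IsTriangleFree.eight_le_egirth (h : IsTriangleFree I) : 8 ≤ (incidenceGraph I).egirth := by
  classical
  rw [le_egirth]
  rintro (x | L) c hc
  · exact_mod_cast h.eight_le_length hc
  · obtain ⟨y, hy⟩ : ∃ y, c.snd = .inl y := by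
      have hadj := c.adj_snd hc.not_nil
      rcases hv : c.snd with y | M
      · exact ⟨y, rfl⟩
      · exact absurd (hv ▸ hadj) not_incidenceGraph_adj_inr_inr
    have hmem : .inl y ∈ c.support := hy ▸ c.getVert_mem_support 1
    have hlen := h.eight_le_length (hc.rotate hmem)
    rw [Walk.length_rotate] at hlen
    exact_mod_cast hlen

/-- The walk of length seven with the given vertices. Together with the edge joining its ends it
runs through the vertices and sides of a quadrangle. -/
def quadrangleWalk {x y z w : α} {K L M N : β} (hxK : I x K) (hwK : I w K) (hwN : I w N)
    (hzN : I z N) (hzM : I z M) (hyM : I y M) (hyL : I y L) :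
    (incidenceGraph I).Walk (.inl x) (.inr L) :=
  walkVia hxK hwK <| walkVia hwN hzN <| walkVia hzM hyM
    (incidenceGraph_adj_inl_inr.2 hyL).toWalk

lemma isPath_quadrangleWalk_iff {x y z w : α} {K L M N : β} (hxK : I x K) (hwK : I w K)
    (hwN : I w N) (hzN : I z N) (hzM : I z M) (hyM : I y M) (hyL : I y L) :
    (quadrangleWalk hxK hwK hwN hzN hzM hyM hyL).IsPath ↔
      [x, w, z, y].Nodup ∧ [L, M, N, K].Nodup := by
  rw [Walk.isPath_def]
  simp only [quadrangleWalk, support_walkVia, Walk.support_cons, Walk.support_nil, List.nodup_cons,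
    List.mem_cons, reduceCtorEq, Sum.inl.injEq, List.not_mem_nil, or_self, or_false, false_or,
    not_or, Sum.inr.injEq, not_false_eq_true, List.nodup_nil, and_self, and_true]
  tauto

lemma exists_eq_quadrangleWalk {x : α} {L : β} (p : (incidenceGraph I).Walk (.inl x) (.inr L))
    (hp : p.length = 7) : ∃ (K M N : β) (w z y : α) (hxK : I x K) (hwK : I w K) (hwN : I w N)
      (hzN : I z N) (hzM : I z M) (hyM : I y M) (hyL : I y L),
      p = quadrangleWalk hxK hwK hwN hzN hzM hyM hyL := by
  obtain ⟨K, w, hxK, hwK, p, rfl⟩ := exists_eq_walkVia p (by lia)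
  rw [length_walkVia] at hp
  obtain ⟨N, z, hwN, hzN, p, rfl⟩ := exists_eq_walkVia p (by lia)
  rw [length_walkVia] at hp
  obtain ⟨M, y, hzM, hyM, p, rfl⟩ := exists_eq_walkVia p (by lia)
  rw [length_walkVia] at hp
  obtain ⟨hyL, rfl⟩ : ∃ hyL : I y L, p = (incidenceGraph_adj_inl_inr.2 hyL).toWalk := by
    cases p with
    | cons hyv p =>
      rw [Walk.length_cons] at hp
      have hp : p.length = 0 := by lia
      obtain rfl := Walk.eq_of_length_eq_zero hp
      obtain rfl := (Walk.length_eq_zero_iff.1 hp).eq_nil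
      exact ⟨hyv, rfl⟩
  exact ⟨K, M, N, w, z, y, hxK, hwK, hwN, hzN, hzM, hyM, hyL, rfl⟩

/-- The tuples `((w, M), z, N)` for which `x K w N z M y L` is a quadrangle, given `x`, `K`, `y`
and `L`. -/
def quadrangleCompletions (I : α → β → Prop) (x : α) (K : β) (y : α) (L : β) :
    Set ((α × β) × α × β) :=
  {c | (I c.1.1 K ∧ c.1.1 ≠ x) ∧ (I y c.1.2 ∧ c.1.2 ≠ L) ∧ IsProj I c.1.1 c.1.2 c.2.1 c.2.2}

lemma IsTriangleFree.injOn_fst_quadrangleCompletions (h : IsTriangleFree I) {x y : α} {K L : β}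
    (hxK : I x K) (hxL : I x L) (hyL : I y L) (hKL : K ≠ L) (hxy : x ≠ y) :
    Set.InjOn Prod.fst (quadrangleCompletions I x K y L) := by
  rintro ⟨⟨w, M⟩, z, N⟩ ⟨⟨hwK, -⟩, ⟨hyM, hML⟩, hproj⟩ ⟨-, z', N'⟩ ⟨-, -, hproj'⟩ rfl
  have hwM : ¬ I w M := h.not_inc_of_isPath hxK hwK hxL hyL hyM hxy hKL hML.symm
  obtain ⟨rfl, rfl⟩ := h.proj_unique hwM hproj hproj'
  rfl

theorem IsTriangleFree.ncard_isPath_length_seven (h : IsTriangleFree I) {x : α} {L : β}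
    (hxL : I x L) {m : ℕ} (hm : ∀ K y, I x K → K ≠ L → I y L → y ≠ x →
      (quadrangleCompletions I x K y L).ncard = m) :
    {p : (incidenceGraph I).Walk (.inl x) (.inr L) | p.IsPath ∧ p.length = 7}.ncard =
      {K | I x K ∧ K ≠ L}.ncard * {y | I y L ∧ y ≠ x}.ncard * m := by
  let S := Σ k : {K // I x K ∧ K ≠ L} × {y // I y L ∧ y ≠ x}, quadrangleCompletions I x k.1 k.2 L
  have hS : Nat.card S = {K | I x K ∧ K ≠ L}.ncard * {y | I y L ∧ y ≠ x}.ncard * m := by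
    have hC (k : {K // I x K ∧ K ≠ L} × {y // I y L ∧ y ≠ x}) :
        Nat.card (quadrangleCompletions I x k.1 k.2 L) = m :=
      hm k.1 k.2 k.1.2.1 k.1.2.2 k.2.2.1 k.2.2.2
    rw [card_sigma_of_card_eq hC, Nat.card_prod]
    rfl
  rw [← hS, ← Nat.card_coe_set_eq]
  symm
  let f (σ : S) : (incidenceGraph I).Walk (.inl x) (.inr L) :=
    quadrangleWalk σ.1.1.2.1 σ.2.2.1.1 σ.2.2.2.2.1 σ.2.2.2.2.2.1 σ.2.2.2.2.2.2 σ.2.2.2.1.1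
      σ.1.2.2.1
  refine Nat.card_eq_of_bijective (fun σ => ⟨f σ, ?_, rfl⟩) ⟨?_, ?_⟩
  · obtain ⟨⟨⟨K, hxK, hKL⟩, y, hyL, hyx⟩, ⟨⟨w, M⟩, z, N⟩,
      ⟨hwK, hwx⟩, ⟨hyM, hML⟩, hwN, hzN, hzM⟩ := σ
    exact (isPath_quadrangleWalk_iff _ _ _ _ _ _ _).2
      ⟨h.nodup_points hxK hwK hwN hzN hzM hyM hyL hxL hKL hyx.symm hwx.symm hML.symm,
        h.nodup_lines hxK hwK hwN hzN hzM hyM hyL hxL hKL hyx.symm hwx.symm hML.symm⟩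
  · rintro ⟨⟨⟨K, _⟩, y, _⟩, ⟨⟨w, M⟩, z, N⟩, _⟩ ⟨⟨⟨K', _⟩, y', _⟩, ⟨⟨w', M'⟩, z', N'⟩, _⟩ hσ
    obtain ⟨rfl, rfl, rfl, rfl, rfl, rfl⟩ :
        K = K' ∧ w = w' ∧ N = N' ∧ z = z' ∧ M = M' ∧ y = y' := by
      simpa [f, quadrangleWalk] using congrArg Walk.support (congrArg Subtype.val hσ)
    rfl
  · rintro ⟨p, hp, hlen⟩
    obtain ⟨K, M, N, w, z, y, hxK, hwK, hwN, hzN, hzM, hyM, hyL, rfl⟩ :=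
      exists_eq_quadrangleWalk p hlen
    obtain ⟨hpoints, hlines⟩ := (isPath_quadrangleWalk_iff _ _ _ _ _ _ _).1 hp
    obtain ⟨hxw, -, hxy⟩ : x ≠ w ∧ x ≠ z ∧ x ≠ y := by
      simpa using (List.nodup_cons.1 hpoints).1
    obtain ⟨hLM, -, hLK⟩ : L ≠ M ∧ L ≠ N ∧ L ≠ K := by
      simpa using (List.nodup_cons.1 hlines).1
    exact ⟨⟨⟨⟨K, hxK, hLK.symm⟩, y, hyL, hxy.symm⟩, ((w, M), z, N),
      ⟨hwK, hxw.symm⟩, ⟨hyM, hLM.symm⟩, hwN, hzN, hzM⟩, rfl⟩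

end IncidenceGraph

section Far

variable {α β : Type*} {I : α → β → Prop} {P x y z w : α} {e K M N Q R : β}

/-- The point `x` is not collinear with `P`. Applied to `flip I`: two lines do not meet. -/
def IsFar (I : α → β → Prop) (P x : α) : Prop := ¬ ∃ L, I P L ∧ I x L

lemma IsFar.not_inc (hx : IsFar I P x) (hxM : I x M) : ¬ I P M :=
  fun hPM => hx ⟨M, hPM, hxM⟩

/-- Incidence between the points not collinear with `P` and the lines not meeting `e`. -/
def farIncidence (I : α → β → Prop) (P : α) (e : β) (x : {x // IsFar I P x})
    (M : {M // IsFar (flip I) e M}) : Prop :=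
  I x M

namespace IsTriangleFree

lemma farIncidence (h : IsTriangleFree I) (P : α) (e : β) : IsTriangleFree (farIncidence I P e) :=
  h.comap Subtype.val_injective Subtype.val_injective

lemma isFar_iff_ne (h : IsTriangleFree I) (hPM : ¬ I P M) (hproj : IsProj I P M z Q)
    (hxM : I x M) : IsFar I P x ↔ x ≠ z := by
  constructor
  · rintro hx rfl
    exact hx ⟨Q, hproj.1, hproj.2.1⟩
  · rintro hxz ⟨N, hPN, hxN⟩
    exact hxz (h.proj_unique hPM ⟨hPN, hxN, hxM⟩ hproj).1

lemma isFar_flip_iff_ne (h : IsTriangleFree I) (hPe : I P e) (hPM : ¬ I P M)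
    (hproj : IsProj I P M z Q) : IsFar (flip I) e M ↔ Q ≠ e := by
  constructor
  · rintro hM rfl
    exact hM ⟨z, hproj.2.1, hproj.2.2⟩
  · rintro hQe ⟨u, hue, huM⟩
    exact hQe (h.proj_unique hPM hproj ⟨hPe, hue, huM⟩).2

-- `z` is the point of `M` collinear with `P` and `w` is its projection on `K`. If `w` is collinear
-- with `P` too, it is the projection `w₀` of `P` on `K`, so `z` lies on the line `R = P w₀`.
lemma isFar_iff_line_ne (h : IsTriangleFree I) {w₀ z₁ : α} {M₁ : β} (hPK : ¬ I P K)
    (hw₀ : IsProj I P K w₀ R) (hyR : ¬ I y R) (hz₁ : IsProj I y R z₁ M₁) (hyM : I y M)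
    (hPM : ¬ I P M) (hz : IsProj I P M z Q) (hzK : ¬ I z K) (hw : IsProj I z K w N) :
    IsFar I P w ↔ M ≠ M₁ := by
  rw [h.isFar_iff_ne hPK hw₀ hw.2.2, not_iff_not]
  constructor
  · rintro rfl
    have hzR : I z R := by
      by_contra hzR
      obtain ⟨rfl, -⟩ := h.proj_unique hzR ⟨hz.2.1, hz.1, hw₀.1⟩ ⟨hw.1, hw.2.1, hw₀.2.1⟩
      exact hPK hw.2.2
    exact (h.proj_unique hyR ⟨hyM, hz.2.2, hzR⟩ hz₁).2
  · rintro rfl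
    obtain ⟨rfl, rfl⟩ := h.proj_unique hPM hz ⟨hw₀.1, hz₁.2.2, hz₁.2.1⟩
    exact (h.proj_unique hzK hw ⟨hz.2.1, hw₀.2.1, hw₀.2.2⟩).1

end IsTriangleFree

end Far

namespace IsGeneralizedQuadrangle

variable {α β : Type*} {I : α → β → Prop} {s t : ℕ}

protected theorem dual (h : IsGeneralizedQuadrangle I s t) :
    IsGeneralizedQuadrangle (flip I) t s where
  nonempty_points := h.nonempty_lines
  nonempty_lines := h.nonempty_points
  one_le_s := h.one_le_t
  one_le_t := h.one_le_s
  card_lines := h.card_points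
  card_points := h.card_lines
  eq_or_eq L M x y hxL hxM hyL hyM := (h.eq_or_eq x y L M hxL hyL hxM hyM).symm
  existsUnique_proj L x hxL := by
    obtain ⟨⟨y, M⟩, hproj, hunique⟩ := h.existsUnique_proj x L hxL
    refine ⟨(M, y), isProj_flip.2 hproj, ?_⟩
    rintro ⟨N, z⟩ hN
    exact congrArg Prod.swap (hunique (z, N) (isProj_flip.1 hN))

theorem isTriangleFree (h : IsGeneralizedQuadrangle I s t) : IsTriangleFree I where
  eq_or_eq hxL hyL hxM hyM := h.eq_or_eq _ _ _ _ hxL hyL hxM hyM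
  proj_unique hxL hM hN := Prod.mk.inj ((h.existsUnique_proj _ _ hxL).unique hM hN)

lemma exists_inc (h : IsGeneralizedQuadrangle I s t) : ∃ x L, I x L := by
  obtain ⟨x⟩ := h.nonempty_points
  have hcard : {L | I x L}.ncard ≠ 0 := by
    rw [h.card_lines x]
    exact Nat.succ_ne_zero t
  exact ⟨x, Set.nonempty_of_ncard_ne_zero hcard⟩

lemma exists_isProj (h : IsGeneralizedQuadrangle I s t) {x : α} {L : β} (hxL : ¬ I x L) :
    ∃ y M, IsProj I x L y M := by
  obtain ⟨⟨y, M⟩, hproj, -⟩ := h.existsUnique_proj x L hxL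
  exact ⟨y, M, hproj⟩

lemma ncard_lines_ne (h : IsGeneralizedQuadrangle I s t) {x : α} {L : β} (hxL : I x L) :
    {M | I x M ∧ M ≠ L}.ncard = t :=
  (Set.ncard_sdiff_singleton_of_mem (s := {M | I x M}) hxL).trans
    (congrArg Nat.pred (h.card_lines x))

lemma ncard_points_ne (h : IsGeneralizedQuadrangle I s t) {x : α} {L : β} (hxL : I x L) :
    {y | I y L ∧ y ≠ x}.ncard = s :=
  h.dual.ncard_lines_ne hxL

variable {P : α} {e : β}

-- A point not collinear with `P` is determined by its projection `(y, M)` on `e` and its position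
-- on `M`.
theorem card_isFar (h : IsGeneralizedQuadrangle I s t) (hPe : I P e) :
    Nat.card {x // IsFar I P x} = s * (t * s) := by
  let S := Σ y : {y // I y e ∧ y ≠ P}, Σ M : {M // I y.1 M ∧ M ≠ e}, {x // I x M.1 ∧ x ≠ y.1}
  have hM (y : {y // I y e ∧ y ≠ P}) :
      Nat.card (Σ M : {M // I y.1 M ∧ M ≠ e}, {x // I x M.1 ∧ x ≠ y.1}) = t * s := by
    have hx (M : {M // I y.1 M ∧ M ≠ e}) : Nat.card {x // I x M.1 ∧ x ≠ y.1} = s :=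
      h.ncard_points_ne M.2.1
    exact (card_sigma_of_card_eq hx).trans (congrArg (· * s) (h.ncard_lines_ne y.2.1))
  have hS : Nat.card S = s * (t * s) :=
    (card_sigma_of_card_eq hM).trans (congrArg (· * (t * s)) (h.ncard_points_ne hPe))
  rw [← hS]
  symm
  have hproj (p : S) : ¬ I p.2.2.1 e ∧ IsProj I p.2.2.1 e p.1 p.2.1 :=
    ⟨h.isTriangleFree.not_inc p.2.1.2.1 p.2.2.2.1 p.1.2.1 p.2.2.2.2.symm p.2.1.2.2,
      p.2.2.2.1, p.2.1.2.1, p.1.2.1⟩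
  refine Nat.card_eq_of_bijective (fun p => ⟨p.2.2.1, ?_⟩) ⟨?_, ?_⟩
  · rintro ⟨N, hPN, hxN⟩
    exact p.1.2.2 (h.isTriangleFree.proj_unique (hproj p).1 (hproj p).2 ⟨hxN, hPN, hPe⟩).1
  · intro p p' hpp'
    obtain ⟨hxe, hxp⟩ := hproj p
    have hxp' := (hproj p').2
    obtain ⟨⟨y, _⟩, ⟨M, _⟩, ⟨x, _⟩⟩ := p
    obtain ⟨⟨y', _⟩, ⟨M', _⟩, ⟨x', _⟩⟩ := p'
    obtain rfl : x = x' := congrArg Subtype.val hpp'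
    obtain ⟨rfl, rfl⟩ := h.isTriangleFree.proj_unique hxe hxp hxp'
    rfl
  · rintro ⟨x, hx⟩
    have hxe : ¬ I x e := fun hxe => hx.not_inc hxe hPe
    obtain ⟨y, M, hxM, hyM, hye⟩ := h.exists_isProj hxe
    have hyP : y ≠ P := fun hyP => hx.not_inc hxM (hyP ▸ hyM)
    have hMe : M ≠ e := fun hMe => hxe (hMe ▸ hxM)
    have hxy : x ≠ y := fun hxy => hxe (hxy ▸ hye)
    exact ⟨⟨⟨y, hye, hyP⟩, ⟨M, hyM, hMe⟩, ⟨x, hxM, hxy⟩⟩, rfl⟩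

theorem ncard_farIncidence_lines (h : IsGeneralizedQuadrangle I s t) (hPe : I P e)
    (x : {x // IsFar I P x}) : {M | farIncidence I P e x M}.ncard = t := by
  have hxe : ¬ I x e := fun hxe => x.2.not_inc hxe hPe
  obtain ⟨y, N, hproj⟩ := h.exists_isProj hxe
  rw [← h.ncard_lines_ne hproj.1, ← Set.ncard_image_of_injective _ Subtype.val_injective]
  congr 1
  ext M
  have hfar (hxM : I x M) : IsFar (flip I) e M ↔ M ≠ N :=
    h.dual.isTriangleFree.isFar_iff_ne hxe (isProj_flip.2 hproj) hxM
  constructor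
  · rintro ⟨M, hxM, rfl⟩
    exact ⟨hxM, (hfar hxM).1 M.2⟩
  · rintro ⟨hxM, hMN⟩
    exact ⟨⟨M, (hfar hxM).2 hMN⟩, hxM, rfl⟩

theorem ncard_farIncidence_points (h : IsGeneralizedQuadrangle I s t) (hPe : I P e)
    (L : {M // IsFar (flip I) e M}) : {x | farIncidence I P e x L}.ncard = s :=
  h.dual.ncard_farIncidence_lines hPe L

section Quadrangles

variable {x y : {x // IsFar I P x}} {K L M : {M // IsFar (flip I) e M}}

/-- The pairs of a point `w` of `K` and a line `M` through `y` in the far geometry for which the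
point `z` of the connecting path `w N z M` is not in the far geometry. -/
def nearPointPairs (I : α → β → Prop) (P : α) (e : β) (x : {x // IsFar I P x})
    (K : {M // IsFar (flip I) e M}) (y : {x // IsFar I P x}) (L : {M // IsFar (flip I) e M}) :
    Set ({x // IsFar I P x} × {M // IsFar (flip I) e M}) :=
  {p | (farIncidence I P e p.1 K ∧ p.1 ≠ x) ∧ (farIncidence I P e y p.2 ∧ p.2 ≠ L) ∧
    ∃ z N, IsProj I p.1 p.2 z N ∧ ¬ IsFar I P z}

lemma not_inc_of_farIncidence (hI : IsTriangleFree I) (hxK : farIncidence I P e x K)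
    (hxL : farIncidence I P e x L) (hyL : farIncidence I P e y L) (hKL : K ≠ L) (hxy : x ≠ y)
    (hyM : farIncidence I P e y M) (hML : M ≠ L) {z : α} (hzM : I z M) : ¬ I z K := fun hzK =>
  hI.not_inc_of_isPath hxK hzK hxL hyL hyM (Subtype.coe_ne_coe.2 hxy) (Subtype.coe_ne_coe.2 hKL)
    (Subtype.coe_ne_coe.2 hML.symm) hzM

lemma mk_mem_nearPointPairs_iff (hI : IsTriangleFree I) (hxL : farIncidence I P e x L)
    (hyL : farIncidence I P e y L) (hxy : x ≠ y) (hyM : farIncidence I P e y M) (hML : M ≠ L)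
    {w : {x // IsFar I P x}} {z : α} {Q : β} (hz : IsProj I P M z Q) (hzK : ¬ I z K) :
    (w, M) ∈ nearPointPairs I P e x K y L ↔ ∃ N, IsProj I z K w N := by
  constructor
  · rintro ⟨⟨hwK, -⟩, -, z', N, ⟨hwN, hz'N, hz'M⟩, hz'⟩
    obtain rfl : z' = z := by
      by_contra hne
      exact hz' ((hI.isFar_iff_ne (y.2.not_inc hyM) hz hz'M).2 hne)
    exact ⟨N, hz'N, hwN, hwK⟩
  · rintro ⟨N, hzN, hwN, hwK⟩
    refine ⟨⟨hwK, ?_⟩, ⟨hyM, hML⟩, z, N, ⟨hwN, hzN, hz.2.2⟩, not_not.2 ⟨Q, hz.1, hz.2.1⟩⟩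
    rintro rfl
    have hwM : ¬ I w M := hI.not_inc hyL hxL hyM (Subtype.coe_ne_coe.2 hxy.symm)
      (Subtype.coe_ne_coe.2 hML.symm)
    obtain ⟨rfl, -⟩ := hI.proj_unique hwM ⟨hwN, hzN, hz.2.2⟩ ⟨hxL, hyL, hyM⟩
    exact y.2 ⟨Q, hz.1, hz.2.1⟩

lemma exists_line_forall_isFar_iff_ne (h : IsGeneralizedQuadrangle I s t) (hPe : I P e)
    (hxK : farIncidence I P e x K) (hxL : farIncidence I P e x L) (hyL : farIncidence I P e y L)
    (hKL : K ≠ L) :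
    ∃ M₁, farIncidence I P e y M₁ ∧ M₁ ≠ L ∧ ∀ {M : {M // IsFar (flip I) e M}} {z w : α} {Q N : β},
      farIncidence I P e y M → IsProj I P M z Q → ¬ I z K → IsProj I z K w N →
        (IsFar I P w ↔ M ≠ M₁) := by
  have hI := h.isTriangleFree
  have hPK : ¬ I P K := x.2.not_inc hxK
  obtain ⟨w₀, R, hw₀⟩ := h.exists_isProj hPK
  have hxR : ¬ I x R := fun hxR => x.2.not_inc hxR hw₀.1
  have hyR : ¬ I y R := fun hyR => y.2.not_inc hyR hw₀.1
  obtain ⟨z₁, M₁, hz₁⟩ := h.exists_isProj hyR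
  have hM₁ : IsFar (flip I) e M₁ :=
    (hI.isFar_flip_iff_ne hPe (y.2.not_inc hz₁.1) ⟨hw₀.1, hz₁.2.2, hz₁.2.1⟩).2
      ((hI.isFar_flip_iff_ne hPe hPK hw₀).1 K.2)
  refine ⟨⟨M₁, hM₁⟩, hz₁.1, ?_, fun {M} _ _ _ _ hyM hz hzK hw => ?_⟩
  · rintro rfl
    exact hKL (Subtype.ext (hI.proj_unique hxR ⟨hxK, hw₀.2.2, hw₀.2.1⟩ ⟨hxL, hz₁.2⟩).2)
  · rw [Ne, Subtype.ext_iff]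
    exact hI.isFar_iff_line_ne hPK hw₀ hyR hz₁ hyM (y.2.not_inc hyM) hz hzK hw

theorem ncard_nearPointPairs (h : IsGeneralizedQuadrangle I s t) (hPe : I P e)
    (hxK : farIncidence I P e x K) (hxL : farIncidence I P e x L) (hyL : farIncidence I P e y L)
    (hKL : K ≠ L) (hxy : x ≠ y) : (nearPointPairs I P e x K y L).ncard = t - 2 := by
  have hI := h.isTriangleFree
  obtain ⟨M₁, hyM₁, hM₁L, hfar⟩ := h.exists_line_forall_isFar_iff_ne hPe hxK hxL hyL hKL
  have hcard : ({M | farIncidence I P e y M} \ {M₁, L}).ncard = t - 2 := by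
    have hsub : {M₁, L} ⊆ {M | farIncidence I P e y M} := Set.pair_subset hyM₁ hyL
    rw [Set.ncard_sdiff hsub, h.ncard_farIncidence_lines hPe, Set.ncard_pair hM₁L]
  rw [← hcard]
  have hproj {M : {M // IsFar (flip I) e M}} (hyM : farIncidence I P e y M) (hML : M ≠ L) :
      ∃ z Q, IsProj I P M z Q ∧ ¬ I z K ∧
        ∀ w, (w, M) ∈ nearPointPairs I P e x K y L ↔ ∃ N, IsProj I z K w N := by
    obtain ⟨z, Q, hz⟩ := h.exists_isProj (y.2.not_inc hyM)
    have hzK := not_inc_of_farIncidence hI hxK hxL hyL hKL hxy hyM hML hz.2.2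
    exact ⟨z, Q, hz, hzK, fun w => mk_mem_nearPointPairs_iff hI hxL hyL hxy hyM hML hz hzK⟩
  refine Set.ncard_congr (fun p _ => p.2) ?_ ?_ ?_
  · rintro ⟨w, M⟩ hwM
    obtain ⟨-, ⟨hyM, hML⟩, -⟩ := id hwM
    obtain ⟨z, Q, hz, hzK, hmem⟩ := hproj hyM hML
    obtain ⟨N, hw⟩ := (hmem w).1 hwM
    exact ⟨hyM, not_or.2 ⟨(hfar hyM hz hzK hw).1 w.2, hML⟩⟩
  · rintro ⟨w, M⟩ ⟨w', M'⟩ hwM hwM' (rfl : M = M')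
    obtain ⟨-, ⟨hyM, hML⟩, -⟩ := id hwM
    obtain ⟨z, -, -, hzK, hmem⟩ := hproj hyM hML
    obtain ⟨N, hw⟩ := (hmem w).1 hwM
    obtain ⟨N', hw'⟩ := (hmem w').1 hwM'
    exact Prod.ext (Subtype.ext (hI.proj_unique hzK hw hw').1) rfl
  · rintro M ⟨hyM, hM⟩
    obtain ⟨hMM₁, hML⟩ := not_or.1 hM
    obtain ⟨z, Q, hz, hzK, hmem⟩ := hproj hyM hML
    obtain ⟨w, N, hw⟩ := h.exists_isProj hzK
    exact ⟨(⟨w, (hfar hyM hz hzK hw).2 hMM₁⟩, M), (hmem _).2 ⟨N, hw⟩, rfl⟩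

/-- The pairs of a point `w` of `K` and a line `M` through `y` in the far geometry for which the
line `N` of the connecting path `w N z M` is not in the far geometry. -/
def nearLinePairs (I : α → β → Prop) (P : α) (e : β) (x : {x // IsFar I P x})
    (K : {M // IsFar (flip I) e M}) (y : {x // IsFar I P x}) (L : {M // IsFar (flip I) e M}) :
    Set ({x // IsFar I P x} × {M // IsFar (flip I) e M}) :=
  Prod.swap ⁻¹' nearPointPairs (flip I) e P L y K x

lemma mem_nearLinePairs_iff {p : {x // IsFar I P x} × {M // IsFar (flip I) e M}} :
    p ∈ nearLinePairs I P e x K y L ↔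
      (farIncidence I P e p.1 K ∧ p.1 ≠ x) ∧ (farIncidence I P e y p.2 ∧ p.2 ≠ L) ∧
        ∃ z N, IsProj I p.1 p.2 z N ∧ ¬ IsFar (flip I) e N := by
  constructor
  · rintro ⟨hM, hw, N, z, hproj, hN⟩
    exact ⟨hw, hM, z, N, isProj_flip.1 hproj, hN⟩
  · rintro ⟨hw, hM, z, N, hproj, hN⟩
    exact ⟨hM, hw, N, z, isProj_flip.2 hproj, hN⟩

lemma ncard_nearLinePairs (h : IsGeneralizedQuadrangle I s t) (hPe : I P e)
    (hxK : farIncidence I P e x K) (hxL : farIncidence I P e x L) (hyL : farIncidence I P e y L)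
    (hKL : K ≠ L) (hxy : x ≠ y) : (nearLinePairs I P e x K y L).ncard = s - 2 :=
  (Set.ncard_preimage_of_injective_subset_range Prod.swap_injective
    (Prod.swap_surjective.range_eq ▸ Set.subset_univ _)).trans
    (h.dual.ncard_nearPointPairs hPe hyL hxL hxK hxy.symm hKL.symm)

lemma disjoint_nearPointPairs_nearLinePairs (hI : IsTriangleFree I) (hPe : I P e)
    (hxK : farIncidence I P e x K) (hxL : farIncidence I P e x L) (hyL : farIncidence I P e y L)
    (hKL : K ≠ L) (hxy : x ≠ y) :
    Disjoint (nearPointPairs I P e x K y L) (nearLinePairs I P e x K y L) := by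
  rw [Set.disjoint_left]
  rintro ⟨w, M⟩ ⟨⟨hwK, -⟩, ⟨hyM, hML⟩, z, N, hproj, hz⟩ hwM
  obtain ⟨-, -, z', N', hproj', hN⟩ := mem_nearLinePairs_iff.1 hwM
  have hwM : ¬ I w M := fun hwM =>
    not_inc_of_farIncidence hI hxK hxL hyL hKL hxy hyM hML hwM hwK
  obtain ⟨rfl, rfl⟩ := hI.proj_unique hwM hproj' hproj
  obtain ⟨Q, hPQ, hzQ⟩ := not_not.1 hz
  obtain ⟨u, hue, huN⟩ := not_not.1 hN
  have hze : ¬ I z' e := fun hze => M.2 ⟨z', hze, hproj.2.2⟩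
  obtain ⟨-, rfl⟩ := hI.proj_unique hze ⟨hproj.2.1, huN, hue⟩ ⟨hzQ, hPQ, hPe⟩
  exact w.2 ⟨N', hPQ, hproj.1⟩

lemma image_fst_quadrangleCompletions_farIncidence (h : IsGeneralizedQuadrangle I s t)
    (hxK : farIncidence I P e x K) (hxL : farIncidence I P e x L) (hyL : farIncidence I P e y L)
    (hKL : K ≠ L) (hxy : x ≠ y) :
    Prod.fst '' quadrangleCompletions (farIncidence I P e) x K y L =
      ({w | farIncidence I P e w K ∧ w ≠ x} ×ˢ {M | farIncidence I P e y M ∧ M ≠ L}) \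
        (nearPointPairs I P e x K y L ∪ nearLinePairs I P e x K y L) := by
  have hI := h.isTriangleFree
  have hwM {w M} (hwK : farIncidence I P e w K) (hyM : farIncidence I P e y M) (hML : M ≠ L) :
      ¬ I w M := fun hwM => not_inc_of_farIncidence hI hxK hxL hyL hKL hxy hyM hML hwM hwK
  ext ⟨w, M⟩
  constructor
  · rintro ⟨⟨_, z, N⟩, ⟨hw, hM, hproj⟩, rfl⟩
    refine ⟨⟨hw, hM⟩, ?_⟩
    rintro (⟨-, -, z', N', hproj', hz'⟩ | hnear)
    · obtain ⟨rfl, -⟩ := hI.proj_unique (hwM hw.1 hM.1 hM.2) hproj hproj'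
      exact hz' z.2
    · obtain ⟨-, -, z', N', hproj', hN'⟩ := mem_nearLinePairs_iff.1 hnear
      obtain ⟨-, rfl⟩ := hI.proj_unique (hwM hw.1 hM.1 hM.2) hproj hproj'
      exact hN' N.2
  · rintro ⟨⟨hw, hM⟩, hnear⟩
    obtain ⟨hz, hN⟩ := not_or.1 hnear
    obtain ⟨z, N, hproj⟩ := h.exists_isProj (hwM hw.1 hM.1 hM.2)
    have hzfar : IsFar I P z := by
      by_contra hzP
      exact hz ⟨hw, hM, z, N, hproj, hzP⟩
    have hNfar : IsFar (flip I) e N := by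
      by_contra hNe
      exact hN (mem_nearLinePairs_iff.2 ⟨hw, hM, z, N, hproj, hNe⟩)
    exact ⟨⟨(w, M), ⟨z, hzfar⟩, ⟨N, hNfar⟩⟩, ⟨hw, hM, hproj⟩, rfl⟩

lemma ncard_farIncidence_lines_ne (h : IsGeneralizedQuadrangle I s t) (hPe : I P e)
    (hxL : farIncidence I P e x L) : {M | farIncidence I P e x M ∧ M ≠ L}.ncard = t - 1 :=
  (Set.ncard_sdiff_singleton_of_mem (s := {M | farIncidence I P e x M}) hxL).trans
    (congrArg (· - 1) (h.ncard_farIncidence_lines hPe x))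

lemma ncard_farIncidence_points_ne (h : IsGeneralizedQuadrangle I s t) (hPe : I P e)
    (hxL : farIncidence I P e x L) : {y | farIncidence I P e y L ∧ y ≠ x}.ncard = s - 1 :=
  h.dual.ncard_farIncidence_lines_ne hPe hxL

theorem ncard_quadrangleCompletions_farIncidence (h : IsGeneralizedQuadrangle I s t) (hs : 2 ≤ s)
    (ht : 2 ≤ t) (hPe : I P e) (hxK : farIncidence I P e x K) (hxL : farIncidence I P e x L)
    (hyL : farIncidence I P e y L) (hKL : K ≠ L) (hxy : x ≠ y) :
    (quadrangleCompletions (farIncidence I P e) x K y L).ncard = (s - 2) * (t - 2) + 1 := by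
  have hI := h.isTriangleFree
  set A := {w | farIncidence I P e w K ∧ w ≠ x}
  set B := {M | farIncidence I P e y M ∧ M ≠ L}
  have hA : A.ncard = s - 1 := h.ncard_farIncidence_points_ne hPe hxK
  have hB : B.ncard = t - 1 := h.ncard_farIncidence_lines_ne hPe hyL
  have hfin : (A ×ˢ B).Finite :=
    (Set.finite_of_ncard_ne_zero (by omega)).prod (Set.finite_of_ncard_ne_zero (by omega))
  have hsub : nearPointPairs I P e x K y L ∪ nearLinePairs I P e x K y L ⊆ A ×ˢ B := by
    rintro p (⟨hw, hM, -⟩ | ⟨hM, hw, -⟩) <;> exact ⟨hw, hM⟩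
  have hnear := hfin.subset hsub
  rw [← (hI.farIncidence P e).injOn_fst_quadrangleCompletions hxK hxL hyL hKL hxy |>.ncard_image,
    h.image_fst_quadrangleCompletions_farIncidence hxK hxL hyL hKL hxy,
    Set.ncard_sdiff hsub hnear, Set.ncard_prod, hA, hB,
    Set.ncard_union_eq (disjoint_nearPointPairs_nearLinePairs hI hPe hxK hxL hyL hKL hxy)
      (hnear.subset Set.subset_union_left) (hnear.subset Set.subset_union_right),
    h.ncard_nearPointPairs hPe hxK hxL hyL hKL hxy, h.ncard_nearLinePairs hPe hxK hxL hyL hKL hxy]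
  obtain ⟨a, rfl⟩ := Nat.exists_eq_add_of_le' hs
  obtain ⟨b, rfl⟩ := Nat.exists_eq_add_of_le' ht
  simp only [Nat.add_sub_cancel, Nat.add_succ_sub_one]
  exact Nat.sub_eq_of_eq_add (by ring)

end Quadrangles

section DeletedIncidenceGraph

open SimpleGraph

theorem ncard_isPath_deletedIncidenceGraph (h : IsGeneralizedQuadrangle I s t) (hs : 2 ≤ s)
    (ht : 2 ≤ t) (hPe : I P e) {x : {x // IsFar I P x}} {L : {M // IsFar (flip I) e M}}
    (hxL : farIncidence I P e x L) :
    {p : (deletedIncidenceGraph I P e).Walk (.inl x) (.inr L) | p.IsPath ∧ p.length = 7}.ncard =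
      (t - 1) * (s - 1) * ((s - 2) * (t - 2) + 1) := by
  refine ((h.isTriangleFree.farIncidence P e).ncard_isPath_length_seven hxL
    fun K y hxK hKL hyL hyx => h.ncard_quadrangleCompletions_farIncidence hs ht hPe hxK hxL hyL hKL
      hyx.symm).trans ?_
  rw [h.ncard_farIncidence_lines_ne hPe hxL, h.ncard_farIncidence_points_ne hPe hxL]

theorem ncard_cycleSubgraphs_deletedIncidenceGraph (h : IsGeneralizedQuadrangle I s t)
    (hs : 2 ≤ s) (ht : 2 ≤ t) (hPe : I P e) {ε : Sym2 _}
    (hε : ε ∈ (deletedIncidenceGraph I P e).edgeSet) :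
    {H | IsCycleSubgraph (deletedIncidenceGraph I P e) 8 H ∧ ε ∈ H.edgeSet}.ncard =
      (t - 1) * (s - 1) * ((s - 2) * (t - 2) + 1) := by
  have hcycles {x L} (hxL : (deletedIncidenceGraph I P e).Adj (.inl x) (.inr L)) :=
    (ncard_cycleSubgraphs_through_edge hxL.symm (n := 7) (by norm_num)).trans
      (h.ncard_isPath_deletedIncidenceGraph hs ht hPe hxL)
  induction ε using Sym2.ind with
  | _ a b =>
    rw [mem_edgeSet] at hε
    rcases a with x | L <;> rcases b with y | M
    · exact hε.elim
    · rw [Sym2.eq_swap]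
      exact hcycles hε
    · exact hcycles hε.symm
    · exact hε.elim

theorem egirth_deletedIncidenceGraph (h : IsGeneralizedQuadrangle I s t) (hs : 2 ≤ s)
    (ht : 2 ≤ t) (hPe : I P e) : (deletedIncidenceGraph I P e).egirth = 8 := by
  refine le_antisymm ?_ (h.isTriangleFree.farIncidence P e).eight_le_egirth
  obtain ⟨x⟩ : Nonempty {x // IsFar I P x} := by
    refine (Nat.card_pos_iff.1 ?_).1
    rw [h.card_isFar hPe]
    positivity
  obtain ⟨L, hxL⟩ : {L | farIncidence I P e x L}.Nonempty := by
    refine Set.nonempty_of_ncard_ne_zero ?_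
    rw [h.ncard_farIncidence_lines hPe]
    omega
  have hcard : 0 < (t - 1) * (s - 1) * ((s - 2) * (t - 2) + 1) :=
    Nat.mul_pos (Nat.mul_pos (by omega) (by omega)) (Nat.succ_pos _)
  rw [← h.ncard_isPath_deletedIncidenceGraph hs ht hPe hxL] at hcard
  obtain ⟨p, hp, hlen⟩ := Set.nonempty_of_ncard_ne_zero hcard.ne'
  have hLx : (deletedIncidenceGraph I P e).Adj (.inr L) (.inl x) := hxL
  refine (egirth_le_length (isCycle_cons_of_isPath hp (by omega) hLx)).trans_eq ?_
  rw [Walk.length_cons, hlen]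
  rfl

theorem isEdgeGirthRegular_deletedIncidenceGraph {q : ℕ} (hq : 2 ≤ q)
    (h : IsGeneralizedQuadrangle I q q) (hPe : I P e) :
    IsEdgeGirthRegular (deletedIncidenceGraph I P e) (2 * q ^ 3) q 8
      ((q - 1) ^ 2 * ((q - 2) ^ 2 + 1)) := by
  have hpoints : Nat.card {x // IsFar I P x} = q * (q * q) := h.card_isFar hPe
  have hlines : Nat.card {M // IsFar (flip I) e M} = q * (q * q) := h.dual.card_isFar hPe
  have hpos : q * (q * q) ≠ 0 := by positivity
  have : Finite {x // IsFar I P x} := Nat.finite_of_card_ne_zero (hpoints ▸ hpos)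
  have : Finite {M // IsFar (flip I) e M} := Nat.finite_of_card_ne_zero (hlines ▸ hpos)
  refine ⟨inferInstanceAs (Finite ({x // IsFar I P x} ⊕ {M // IsFar (flip I) e M})), ?_, ?_,
    h.egirth_deletedIncidenceGraph hq hq hPe, fun ε hε => ?_⟩
  · refine (Nat.card_sum (α := {x // IsFar I P x}) (β := {M // IsFar (flip I) e M})).trans ?_
    rw [hpoints, hlines]
    ring
  · rintro (x | L)
    · exact (ncard_neighborSet_incidenceGraph_inl x).trans (h.ncard_farIncidence_lines hPe x)
    · exact (ncard_neighborSet_incidenceGraph_inr L).trans (h.ncard_farIncidence_points hPe L)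
  · rw [h.ncard_cycleSubgraphs_deletedIncidenceGraph hq hq hPe hε, sq, sq]

end DeletedIncidenceGraph

end IsGeneralizedQuadrangle

theorem mainTheorem12 (q : ℕ) (hq : IsPrimePow q) :
    -- a generalized quadrangle of order `(q, q)` exists
    (∃ (α β : Type) (I : α → β → Prop), IsGeneralizedQuadrangle I q q) ∧
    -- an `egr(2q³, q, 8, (q - 1)²((q - 2)² + 1))` graph exists (note that `2 ≤ q`)
    (∃ (V : Type) (G : SimpleGraph V),
      IsEdgeGirthRegular G (2 * q ^ 3) q 8 ((q - 1) ^ 2 * ((q - 2) ^ 2 + 1))) ∧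
    -- namely, the one constructed from the symplectic quadrangle `W(q)` and any of its flags
    (∀ (F : Type*) [Field F], Nat.card F = q →
      IsGeneralizedQuadrangle (symplecticIncidence F) q q ∧
      ∀ (P : Projectivization F (Fin 4 → F)) (e : SymplecticLine F), symplecticIncidence F P e →
        IsEdgeGirthRegular (deletedIncidenceGraph (symplecticIncidence F) P e)
          (2 * q ^ 3) q 8 ((q - 1) ^ 2 * ((q - 2) ^ 2 + 1))) := by
  have hq0 : q ≠ 0 := hq.ne_zero
  obtain ⟨F₀, _, hF₀⟩ : ∃ (F : Type) (_ : Field F), Nat.card F = q := by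
    obtain ⟨p, k, hp, hk, rfl⟩ := hq
    have := Fact.mk hp.nat_prime
    exact ⟨GaloisField p k, inferInstance, GaloisField.card p k hk.ne'⟩
  have : Finite F₀ := Nat.finite_of_card_ne_zero (hF₀ ▸ hq0)
  have hW₀ : IsGeneralizedQuadrangle (symplecticIncidence F₀) q q :=
    hF₀ ▸ isGeneralizedQuadrangle_symplecticIncidence F₀
  obtain ⟨P₀, e₀, hPe₀⟩ := hW₀.exists_inc
  refine ⟨⟨_, _, _, hW₀⟩,
    ⟨_, _, hW₀.isEdgeGirthRegular_deletedIncidenceGraph hq.two_le hPe₀⟩, fun F _ hF => ?_⟩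
  have : Finite F := Nat.finite_of_card_ne_zero (hF ▸ hq0)
  have hW : IsGeneralizedQuadrangle (symplecticIncidence F) q q :=
    hF ▸ isGeneralizedQuadrangle_symplecticIncidence F
  exact ⟨hW, fun P e hPe => hW.isEdgeGirthRegular_deletedIncidenceGraph hq.two_le hPe⟩
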